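/- **Conventions.** Let $\mathcal H=\{\tau\in\mathbb C:\operatorname{Im}\tau>0\}$, with $g\cdot\tau=\frac{a\tau+b}{c\tau+d}$ for a real matrix $g=\begin{pmatrix}a&b\\c&d\end{pmatrix}$ of positive determinant, and let $\sqrt{\ }$ be the principal square root. For $c\in\mathbb Z$ and odd $d\in\mathbb Z$ let $\left(\frac cd\right)$ be the extended quadratic symbol: the Jacobi symbol if $d>0$, $c\ne0$; $\left(\frac cd\right)=\frac{c}{|c|}\left(\frac{c}{-d}\right)$ if $d<0$, $c\neq0$; $\left(\frac0d\right)=1$ if $d=\pm1$ and $0$ otherwise. Let $\varepsilon_d=1$ if $d\equiv1\bmod 4$, $\varepsilon_d=i$ if $d\equiv3\bmod4$. For $g=\begin{pmatrix}a&b\\c&d\end{pmatrix}\in\Gamma_0(4)$ put $h(g,\tau)=\varepsilon_d^{-1}\left(\frac cd\right)\sqrt{c\tau+d}$. Let $\mathcal G$ be the group of pairs $(g,\phi)$ with $g=\begin{pmatrix}a&b\\c&d\end{pmatrix}\in \mathrm{GL}_2^+(\mathbb Q)$ and $\phi:\mathcal H\to\mathbb C$ holomorphic with $\phi(\tau)^2=c\tau+d$,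 with product $(g_1,\phi_1)(g_2,\phi_2)=(g_1g_2,\ \phi_1(g_2\cdot\tau)\phi_2(\tau))$. For $k\in\frac12\mathbb Z$, $u\in\mathbb C$, $\dot g=(g,\phi)\in\mathcal G$ with $\dot g^{-1}=(g^{-1},\phi')$, and $\psi:\mathcal H\to\mathbb C$, put $$([\dot g]_{k,u}\psi)(\tau)=\phi'(\tau)^{-2k}\det(g)^{-u}\,\psi(g^{-1}\cdot\tau).$$ A function $\psi$ is *holomorphic at $\infty$* if for some integer $m\ge1$ it has an expansion $\psi(\tau)=\sum_{n\ge0}a_ne^{2\pi i n\tau/m}$ on $\mathcal H$. It is *holomorphic at $s\in\mathbb Q$* in weight $k$ if $[\dot h]_{k,u}\psi$ is holomorphic at $\infty$ for some $\dot h=(h,\phi)\in\mathcal G$ with $h\cdot s=\infty$ and some $u\in\mathbb C$. For a congruence subgroup $\Gamma\subseteq\Gamma_1(4)$, a *modular form of weight $k\in\frac12\mathbb Z$ under $\Gamma$* is a holomorphic function $\psi:\mathcal H\to\mathbb C$ such that $h(g^{-1},\tau)^{-2k}\psi(g^{-1}\cdot\tau)=\psi(\tau)$ for all $g\in\Gamma$,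 $\tau\in\mathcal H$, and such that $\psi$ is holomorphic at every $s\in\mathbb Q\cup\{\infty\}$. **Theorem 1.3.** Let $d\ge1$ be an integer, $p$ a prime, $f:(\mathbb Z/p\mathbb Z)^d\to\mathbb C$ a function, and $Q(x,x)=x_1^2+\cdots+x_d^2$. For every $\tau\in\mathcal H$ the series $$\theta_f(\tau)=\sum_{x\in\mathbb Z^d}f(x\bmod p)\,e^{2\pi iQ(x,x)\tau}=\sum_{n=0}^\infty\Bigl(\sum_{x\in\mathbb Z^d,\ Q(x,x)=n}f(x\bmod p)\Bigr)e^{2\pi i n\tau}$$ converge (the first one absolutely) and the equality holds. Moreover: 1. If $p=2$, then $\Gamma_2=\left\{\begin{pmatrix}a&b\\c&d\end{pmatrix}\in \mathrm{SL}_2(\mathbb Z): a,d\equiv1\bmod4,\ c\equiv0\bmod16\right\}$ is a congruence subgroup contained in $\Gamma_1(4)$, and $\theta_f$ is a modular form of weight $\frac d2$ under $\Gamma_2$, where the weight refers to the dimension $d$. 2. If $p$ is odd, then $\Gamma_p=\left\{\begin{pmatrix}a&b\\c&d\end{pmatrix}\in \mathrm{SL}_2(\mathbb Z): a,d\equiv1\bmod4p,\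 c\equiv0\bmod4p^2\right\}$ is a congruence subgroup contained in $\Gamma_1(4)$, and $\theta_f$ is a modular form of weight $\frac d2$ under $\Gamma_p$. -/

import Mathlib

open UpperHalfPlane Matrix CongruenceSubgroup
open scoped MatrixGroups Manifold

noncomputable section

namespace WeightedTheta

/-! ### Weighted theta functions -/

/-- The standard quadratic form `Q(x,x) = x₁² + ⋯ + x_d²` on `ℤ^d`. -/
def quadForm {d : ℕ} (x : Fin d → ℤ) : ℤ := ∑ i, x i * x i

/-- The quadric `X_d(n) = {x ∈ ℤ^d : Q(x,x) = n}`. -/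
def quadric (d n : ℕ) : Set (Fin d → ℤ) := {x | quadForm x = n}

theorem quadric_finite (d n : ℕ) : (quadric d n).Finite := by
  refine (Set.Finite.pi' (fun _ : Fin d => Set.finite_Icc (-(n : ℤ)) n)).subset ?_
  intro x hx i
  have h1 : x i * x i ≤ n := by
    have h2 : ∑ j, x j * x j = (n : ℤ) := hx
    rw [← h2]
    exact Finset.single_le_sum (f := fun j => x j * x j)
      (fun j _ => mul_self_nonneg (x j)) (Finset.mem_univ i)
  constructor <;> nlinarith

/-- Reduction modulo `p`, `ℤ^d → (ℤ/pℤ)^d`. -/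
def reduce {d : ℕ} (p : ℕ) (x : Fin d → ℤ) : Fin d → ZMod p := fun i => (x i : ZMod p)

/-- The summand `f(x mod p) e^{2πi Q(x,x) τ}`. -/
def thetaTerm {d p : ℕ} (f : (Fin d → ZMod p) → ℂ) (τ : ℍ) (x : Fin d → ℤ) : ℂ :=
  f (reduce p x) * Complex.exp (2 * Real.pi * Complex.I * (quadForm x : ℂ) * (τ : ℂ))

/-- The weighted theta function `θ_f(τ) = ∑_{x ∈ ℤ^d} f(x mod p) e^{2πi Q(x,x) τ}`. -/
def weightedTheta {d p : ℕ} (f : (Fin d → ZMod p) → ℂ) (τ : ℍ) : ℂ :=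
  ∑' x : Fin d → ℤ, thetaTerm f τ x

/-- The coefficient `∑_{x ∈ X_d(n)} f(x mod p)`. -/
def thetaCoeff {d p : ℕ} (f : (Fin d → ZMod p) → ℂ) (n : ℕ) : ℂ :=
  ∑ x ∈ (quadric_finite d n).toFinset, f (reduce p x)

/-! ### The two families of groups -/

/-- `Γ₂ = {(a b; c d) ∈ SL₂(ℤ) : a, d ≡ 1 mod 4, c ≡ 0 mod 16}`. -/
def GammaTwo : Subgroup SL(2, ℤ) :=
  (Gamma1 4 ⊓ Gamma0 16).copy
    {g | g 0 0 ≡ 1 [ZMOD 4] ∧ g 1 1 ≡ 1 [ZMOD 4] ∧ g 1 0 ≡ 0 [ZMOD 16]} (by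
      ext g
      simp only [Set.mem_ofPred_eq, SetLike.mem_coe, Subgroup.mem_inf, Gamma1_mem, Gamma0_mem]
      have e1 := ZMod.intCast_eq_intCast_iff (g 0 0) 1 4
      have e2 := ZMod.intCast_eq_intCast_iff (g 1 1) 1 4
      have e3 := ZMod.intCast_eq_intCast_iff (g 1 0) 0 4
      have e4 := ZMod.intCast_eq_intCast_iff (g 1 0) 0 16
      push_cast at e1 e2 e3 e4
      rw [e1, e2, e3, e4]
      constructor
      · rintro ⟨h1, h2, h3⟩
        exact ⟨⟨h1, h2, h3.of_mul_right 4⟩, h3⟩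
      · rintro ⟨⟨h1, h2, -⟩, h3⟩
        exact ⟨h1, h2, h3⟩)

/-- `Γ_p = {(a b; c d) ∈ SL₂(ℤ) : a, d ≡ 1 mod 4p, c ≡ 0 mod 4p²}`. -/
def GammaOdd (p : ℕ) : Subgroup SL(2, ℤ) :=
  (Gamma1 (4 * p) ⊓ Gamma0 (4 * p ^ 2)).copy
    {g | g 0 0 ≡ 1 [ZMOD 4 * p] ∧ g 1 1 ≡ 1 [ZMOD 4 * p] ∧ g 1 0 ≡ 0 [ZMOD 4 * p ^ 2]} (by
      ext g
      simp only [Set.mem_ofPred_eq, SetLike.mem_coe, Subgroup.mem_inf, Gamma1_mem, Gamma0_mem]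
      have e1 := ZMod.intCast_eq_intCast_iff (g 0 0) 1 (4 * p)
      have e2 := ZMod.intCast_eq_intCast_iff (g 1 1) 1 (4 * p)
      have e3 := ZMod.intCast_eq_intCast_iff (g 1 0) 0 (4 * p)
      have e4 := ZMod.intCast_eq_intCast_iff (g 1 0) 0 (4 * p ^ 2)
      rw [Int.cast_one, Nat.cast_mul, Nat.cast_ofNat] at e1 e2
      rw [Int.cast_zero, Nat.cast_mul, Nat.cast_ofNat] at e3 e4
      rw [Nat.cast_pow] at e4
      rw [e1, e2, e3, e4]
      constructor
      · rintro ⟨h1, h2, h3⟩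
        refine ⟨⟨h1, h2, h3.of_dvd ?_⟩, h3⟩
        exact mul_dvd_mul_left 4 (dvd_pow_self _ two_ne_zero)
      · rintro ⟨⟨h1, h2, -⟩, h3⟩
        exact ⟨h1, h2, h3⟩)

/-! ### The theta multiplier -/

/-- The extended quadratic symbol `(c/d)` for `c ∈ ℤ` and odd `d ∈ ℤ`: the Jacobi symbol if
`d > 0` and `c ≠ 0`; `sign(c) (c/|d|)` if `d < 0` and `c ≠ 0`; and `(0/d)` is `1` if `d = ±1`
and `0` otherwise. -/
def quadSymbol (c d : ℤ) : ℤ :=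
  if c = 0 then (if d = 1 ∨ d = -1 then 1 else 0)
  else if d < 0 then c.sign * jacobiSym c d.natAbs
  else jacobiSym c d.natAbs

/-- For odd `d`: `ε_d = 1` if `d ≡ 1 mod 4` and `ε_d = i` if `d ≡ 3 mod 4`. -/
def epsilonFactor (d : ℤ) : ℂ := if d % 4 = 1 then 1 else Complex.I

/-- `h(g,τ) = ε_d⁻¹ (c/d) √(cτ+d)` for `g = (a b; c d) ∈ Γ₀(4)`, with the principal square root. -/
def thetaMultiplier (g : SL(2, ℤ)) (τ : ℍ) : ℂ :=
  (epsilonFactor (g 1 1))⁻¹ * (quadSymbol (g 1 0) (g 1 1) : ℂ) *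
    ((g 1 0 : ℂ) * (τ : ℂ) + (g 1 1 : ℂ)) ^ (1 / 2 : ℂ)

/-- `ψ` is weakly modular of weight `κ/2` under `Γ` (for `Γ ⊆ Γ₁(4)`): for all `g ∈ Γ`,
`h(g⁻¹,τ)^{-κ} ψ(g⁻¹ τ) = ψ(τ)`. -/
def IsWeaklyModular (κ : ℤ) (Γ : Subgroup SL(2, ℤ)) (ψ : ℍ → ℂ) : Prop :=
  ∀ g ∈ Γ, ∀ τ : ℍ, thetaMultiplier g⁻¹ τ ^ (-κ) * ψ (g⁻¹ • τ) = ψ τ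

/-! ### The metaplectic group over `GL₂⁺(ℚ)` -/

/-- A matrix in `GL₂⁺(ℚ)` seen in `GL₂(ℝ)`, so that it acts on `ℍ` by Moebius transformations. -/
def toReal (g : GL(2, ℚ)⁺) : GL (Fin 2) ℝ :=
  Matrix.GeneralLinearGroup.map (algebraMap ℚ ℝ) (g : GL (Fin 2) ℚ)

theorem toReal_det_pos (g : GL(2, ℚ)⁺) : 0 < (toReal g).det.val := by
  have h : 0 < (Matrix.GeneralLinearGroup.det (g : GL (Fin 2) ℚ)).val := g.2
  simpa [toReal, Matrix.GeneralLinearGroup.map_det] using h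

theorem toReal_inv (g : GL(2, ℚ)⁺) : toReal g⁻¹ = (toReal g)⁻¹ := by
  simp [toReal]

/-- Elements `(g, φ)` of the metaplectic group: `g = (a b; c d) ∈ GL₂⁺(ℚ)`, and `φ` is a holomorphic
function on `ℍ` with `φ(τ)² = cτ + d` (`UpperHalfPlane.denom`). -/
structure Metaplectic where
  /-- the matrix -/
  mat : GL(2, ℚ)⁺
  /-- the holomorphic square root -/
  root : ℍ → ℂ
  holo : MDiff root
  sq : ∀ τ : ℍ, root τ ^ 2 = denom (toReal mat) τ

theorem Metaplectic.root_ne_zero (x : Metaplectic) (τ : ℍ) : x.root τ ≠ 0 := by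
  intro h
  have := x.sq τ
  rw [h, zero_pow two_ne_zero] at this
  exact denom_ne_zero _ τ this.symm

/-- The inverse for the group law `(g₁, φ₁)(g₂, φ₂) = (g₁g₂, φ₁(g₂ τ) φ₂(τ))`, that is,
`(g, φ)⁻¹ = (g⁻¹, 1/φ(g⁻¹ τ))`. -/
def Metaplectic.inv (x : Metaplectic) : Metaplectic where
  mat := x.mat⁻¹
  root := fun τ => (x.root (toReal x.mat⁻¹ • τ))⁻¹
  holo := by
    have h1 : MDiff (fun τ : ℍ => x.root (toReal x.mat⁻¹ • τ)) :=
      x.holo.comp (mdifferentiable_smul (toReal_det_pos x.mat⁻¹))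
    rw [UpperHalfPlane.mdifferentiable_iff] at h1 ⊢
    exact h1.inv fun z _ => x.root_ne_zero _
  sq := by
    intro τ
    rw [inv_pow, x.sq]
    have hc := denom_cocycle_σ (toReal x.mat) (toReal x.mat⁻¹) τ
    have hs : ∀ z, σ (toReal x.mat⁻¹) z = z := fun z => by
      rw [σ, if_pos (toReal_det_pos _)]; rfl
    rw [hs, toReal_inv, mul_inv_cancel, denom_one] at hc
    rw [toReal_inv]
    exact inv_eq_of_mul_eq_one_right hc.symm

/-- The operator of weight `κ/2` with parameter `u`,
`([ġ]_{κ/2,u} ψ)(τ) = φ'(τ)^{-κ} det(g)^{-u} ψ(g⁻¹ τ)`, where `ġ⁻¹ = (g⁻¹, φ')`. -/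
def Metaplectic.op (x : Metaplectic) (κ : ℤ) (u : ℂ) (ψ : ℍ → ℂ) (τ : ℍ) : ℂ :=
  x.inv.root τ ^ (-κ) * ((toReal x.mat).det.val : ℂ) ^ (-u) * ψ (toReal x.mat⁻¹ • τ)

/-! ### Modular forms of integral or half-integral weight -/

/-- `ψ` has a Fourier expansion `ψ(τ) = ∑_{n ≥ 0} a_n e^{2πi n τ / m}` for some integer `m ≥ 1`. -/
def IsHolomorphicAtInfinity (ψ : ℍ → ℂ) : Prop :=
  ∃ m : ℕ, 0 < m ∧ ∃ a : ℕ → ℂ, ∀ τ : ℍ,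
    HasSum (fun n : ℕ => a n * Complex.exp (2 * Real.pi * Complex.I * (τ : ℂ) / m) ^ n) (ψ τ)

/-- `ψ` is holomorphic at `s ∈ ℚ` (in weight `κ/2`): for some `ḣ` in the metaplectic group with
`h · s = ∞` and some `u ∈ ℂ`, the function `[ḣ]_{κ/2,u} ψ` is holomorphic at `∞`. -/
def IsHolomorphicAt (κ : ℤ) (ψ : ℍ → ℂ) (s : ℚ) : Prop :=
  ∃ (x : Metaplectic) (u : ℂ),
    (x.mat : GL (Fin 2) ℚ) • (s : OnePoint ℚ) = OnePoint.infty ∧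
      IsHolomorphicAtInfinity (x.op κ u ψ)

/-- `ψ` is a modular form of weight `κ/2` under the congruence subgroup `Γ ⊆ Γ₁(4)`. -/
structure IsModularForm (κ : ℤ) (Γ : Subgroup SL(2, ℤ)) (ψ : ℍ → ℂ) : Prop where
  congruence : IsCongruenceSubgroup Γ
  le_Gamma1 : Γ ≤ Gamma1 4
  holomorphic : MDiff ψ
  weaklyModular : IsWeaklyModular κ Γ ψ
  holomorphicAtInfinity : IsHolomorphicAtInfinity ψ
  holomorphicAtRational : ∀ s : ℚ, IsHolomorphicAt κ ψ s

end WeightedTheta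

end

noncomputable section

namespace WeightedTheta

/-! ### Square roots of products -/

/-! Decomposing `f` into indicators of residue vectors writes `θ_f` as a finite combination of
products of `d` one-variable series `residueTheta p r` (`weightedTheta_eq`). By orthogonality of
characters each of these is a finite Fourier sum of values of Jacobi's `ϑ(j/N, 2τ)`
(`residueTheta_eq`), so everything rests on the two-variable theta function.

Weak modularity comes from `thetaLaw`, the transformation of `ϑ(z, 2τ)` under all of `Γ₁(4)` with
the exact multiplier `(c/d)√(cτ+d)`. It is proved by Euclidean descent on `|c|`, multiplying on the
right by translations and by `(1 0; 4k 1)`. For these steps the theta function obeys its periodicity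
and functional equation; the work is to check that symbol and principal root follow along
(`rowMultiplier_add_mul`, `rowMultiplier_mul_add`). At `z = (m/N)(cτ+d)`, the congruences on `c` and
`d` make `z` a lattice translate of `m/N` with trivial total exponential factor, so each residue
class is preserved (`residueTheta_transform`).

At a rational cusp `s`, put `τ ↦ s - 1/τ`. Splitting into classes modulo `p * s.den` turns
`e^{2πix²s}` into constants, and the functional equation yields `√(-iτ)` times a power series in
`e^{2πiτ/m}` (`hasExpansion_residueTheta_rat`). -/

theorem cpow_half_mul {x y : ℂ} (hx : x ≠ 0) (hy : y ≠ 0)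
    (h : x.arg + y.arg ∈ Set.Ioc (-Real.pi) Real.pi) :
    (x * y) ^ (1 / 2 : ℂ) = x ^ (1 / 2 : ℂ) * y ^ (1 / 2 : ℂ) := by
  rw [Complex.cpow_def_of_ne_zero (mul_ne_zero hx hy), Complex.cpow_def_of_ne_zero hx,
    Complex.cpow_def_of_ne_zero hy, ← Complex.exp_add, Complex.log_mul hx hy h, add_mul]

/-- Write `x = (xy)·y⁻¹`: both factors lie in the right half-plane, so their arguments add up inside
`(-π, π)`. This fits the roots of `-iτ` in the functional equation. -/
theorem cpow_half_mul_of_re_pos {x y : ℂ} (hx : x ≠ 0) (hy : 0 < y.re) (hxy : 0 < (x * y).re) :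
    (x * y) ^ (1 / 2 : ℂ) = x ^ (1 / 2 : ℂ) * y ^ (1 / 2 : ℂ) := by
  have hy0 : y ≠ 0 := by rintro rfl; simp at hy
  have h1 := abs_lt.mp (Complex.abs_arg_lt_pi_div_two_iff.mpr (Or.inl hy))
  have h2 := abs_lt.mp (Complex.abs_arg_lt_pi_div_two_iff.mpr (Or.inl hxy))
  have h3 : y.arg ≠ Real.pi := by have := Real.pi_pos; intro h; linarith
  have h4 : (x * y * y⁻¹) ^ (1 / 2 : ℂ) = (x * y) ^ (1 / 2 : ℂ) * (y⁻¹) ^ (1 / 2 : ℂ) := by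
    refine cpow_half_mul (mul_ne_zero hx hy0) (inv_ne_zero hy0) ?_
    rw [Complex.arg_inv, if_neg h3]
    constructor <;> linarith
  rw [mul_inv_cancel_right₀ hy0, Complex.inv_cpow _ _ h3] at h4
  rw [h4, inv_mul_cancel_right₀]
  simpa [Complex.cpow_eq_zero_iff] using hy0

/-- Arguments of opposite sign cannot overflow `(-π, π]`; for arguments of the same sign, an
overflow would keep `Im(xy)` from having the sign of `Im x`. -/
theorem cpow_half_mul_of_im {x y : ℂ} (hx : x ∈ Complex.slitPlane) (hy : y ∈ Complex.slitPlane)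
    (h : x.im * y.im ≤ 0 ∨ 0 < x.im * (x * y).im) :
    (x * y) ^ (1 / 2 : ℂ) = x ^ (1 / 2 : ℂ) * y ^ (1 / 2 : ℂ) := by
  have hx0 := Complex.slitPlane_ne_zero hx
  have hy0 := Complex.slitPlane_ne_zero hy
  refine cpow_half_mul hx0 hy0 ?_
  have hx1 : x.arg < Real.pi :=
    lt_of_le_of_ne (Complex.arg_le_pi x) (Complex.mem_slitPlane_iff_arg.mp hx).1
  have hy1 : y.arg < Real.pi :=
    lt_of_le_of_ne (Complex.arg_le_pi y) (Complex.mem_slitPlane_iff_arg.mp hy).1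
  have hx2 := Complex.neg_pi_lt_arg x
  have hy2 := Complex.neg_pi_lt_arg y
  have him : (x * y).im = ‖x‖ * ‖y‖ * Real.sin (x.arg + y.arg) := by
    conv_lhs => rw [← Complex.norm_mul_exp_arg_mul_I x, ← Complex.norm_mul_exp_arg_mul_I y]
    rw [show ((‖x‖ : ℂ) * Complex.exp (x.arg * Complex.I)) *
      ((‖y‖ : ℂ) * Complex.exp (y.arg * Complex.I)) =
      ((‖x‖ * ‖y‖ : ℝ) : ℂ) * Complex.exp ((x.arg + y.arg : ℝ) * Complex.I) by
        push_cast; rw [add_mul, Complex.exp_add]; ring, Complex.im_ofReal_mul,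
      Complex.exp_ofReal_mul_I_im]
  have hn : 0 < ‖x‖ * ‖y‖ := by positivity
  have key (s : ℝ) (hs : 0 < s * (x * y).im) : 0 < s * Real.sin (x.arg + y.arg) := by
    rw [him] at hs
    have : 0 < ‖x‖ * ‖y‖ * (s * Real.sin (x.arg + y.arg)) := by linarith
    exact (pos_iff_pos_of_mul_pos this).mp hn
  rcases le_or_gt 0 x.im with hxi | hxi
  · have hax := Complex.arg_nonneg_iff.mpr hxi
    rcases le_or_gt 0 y.im with hyi | hyi
    · have hay := Complex.arg_nonneg_iff.mpr hyi
      refine ⟨by linarith, ?_⟩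
      by_contra hc
      rcases h with h | h
      · have : x.im * y.im = 0 := le_antisymm h (mul_nonneg hxi hyi)
        rcases mul_eq_zero.mp this with h0 | h0
        · have : x.arg = 0 := by
            rw [Complex.arg_eq_zero_iff]
            rw [Complex.mem_slitPlane_iff] at hx
            exact ⟨(hx.resolve_right (by simpa using h0)).le, h0⟩
          linarith
        · have : y.arg = 0 := by
            rw [Complex.arg_eq_zero_iff]
            rw [Complex.mem_slitPlane_iff] at hy
            exact ⟨(hy.resolve_right (by simpa using h0)).le, h0⟩
          linarith
      · have h1 := key _ h
        have h2 : 0 < Real.sin (x.arg + y.arg) := pos_of_mul_pos_right h1 hxi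
        have h3 : Real.sin (x.arg + y.arg) < 0 := by
          rw [← Real.sin_sub_two_pi]
          exact Real.sin_neg_of_neg_of_neg_pi_lt (by linarith) (by linarith)
        linarith
    · have hay := Complex.arg_neg_iff.mpr hyi
      exact ⟨by linarith, by linarith⟩
  · have hax := Complex.arg_neg_iff.mpr hxi
    rcases le_or_gt 0 y.im with hyi | hyi
    · have hay := Complex.arg_nonneg_iff.mpr hyi
      exact ⟨by linarith, by linarith⟩
    · have hay := Complex.arg_neg_iff.mpr hyi
      refine ⟨?_, by linarith⟩
      by_contra hc
      rcases h with h | h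
      · nlinarith
      · have h1 := key _ h
        have h2 : Real.sin (x.arg + y.arg) < 0 := by nlinarith
        have h3 : 0 ≤ Real.sin (x.arg + y.arg) := by
          rw [← Real.sin_add_two_pi]
          exact Real.sin_nonneg_of_nonneg_of_le_pi (by linarith) (by linarith)
        linarith

theorem cpow_half_eq_I_mul {w : ℂ} (hw : 0 < w.im) :
    w ^ (1 / 2 : ℂ) = Complex.I * (-w) ^ (1 / 2 : ℂ) := by
  have hw0 : w ≠ 0 := by rintro rfl; simp at hw
  rw [Complex.cpow_def_of_ne_zero hw0, Complex.cpow_def_of_ne_zero (neg_ne_zero.mpr hw0),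
    Complex.log, Complex.log, norm_neg, Complex.arg_neg_eq_arg_sub_pi_of_im_pos hw]
  nth_rewrite 2 [← Complex.exp_pi_div_two_mul_I]
  rw [← Complex.exp_add]
  congr 1
  push_cast
  ring

theorem cpow_half_eq_neg_I_mul {w : ℂ} (hw : w.im < 0) :
    w ^ (1 / 2 : ℂ) = -Complex.I * (-w) ^ (1 / 2 : ℂ) := by
  have h := cpow_half_eq_I_mul (w := -w) (by simpa using hw)
  rw [neg_neg] at h
  rw [h, ← mul_assoc]
  simp

/-! ### The extended quadratic symbol -/

theorem quadSymbol_of_pos (c : ℤ) {n : ℕ} (hn : 0 < n) : quadSymbol c n = jacobiSym c n := by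
  have h : ¬ (n : ℤ) < 0 := by omega
  rw [quadSymbol, if_neg h, Int.natAbs_natCast]
  rcases eq_or_ne c 0 with rfl | hc
  · rw [if_pos rfl]
    rcases eq_or_ne n 1 with rfl | h1
    · simp
    · rw [if_neg (by omega), jacobiSym.zero_left (by omega)]
  · rw [if_neg hc]

theorem quadSymbol_of_neg {c : ℤ} (hc : c ≠ 0) {n : ℕ} (hn : 0 < n) :
    quadSymbol c (-n) = c.sign * jacobiSym c n := by
  rw [quadSymbol, if_neg hc, if_pos (by omega), Int.natAbs_neg, Int.natAbs_natCast]

/-- Modulo `4|m| - 1` the number `4|m|` is `1`, so `|m|` has symbol `1`; the modulus is `3 mod 4`,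
so `-1` has symbol `-1`. This expresses the sign in `quadSymbol` as a Jacobi symbol. -/
theorem jacobiSym_four_mul_sub_one {m : ℤ} (hm : m ≠ 0) :
    jacobiSym m (4 * m.natAbs - 1) = m.sign := by
  set k := m.natAbs with hk
  have hk0 : 0 < k := Int.natAbs_pos.mpr hm
  have hodd : (4 * k - 1) % 2 = 1 := by omega
  have hpos : jacobiSym k (4 * k - 1) = 1 := by
    have h := jacobiSym.div_four_left (a := 4 * k) (b := 4 * k - 1) (by omega) hodd
    rw [Int.mul_ediv_cancel_left _ (by norm_num)] at h
    rw [h, jacobiSym.mod_left, show ((4 * k - 1 : ℕ) : ℤ) = 4 * k - 1 by omega]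
    have : (4 * (k : ℤ)) % (4 * k - 1) = 1 :=
      (Int.emod_eq_iff (by omega)).mpr ⟨by norm_num, by omega, ⟨-1, by ring⟩⟩
    rw [this, jacobiSym.one_left]
  rcases lt_or_gt_of_ne hm with h | h
  · have : m = -(k : ℤ) := by omega
    rw [this, jacobiSym.neg _ (Nat.odd_iff.mpr hodd), hpos, ZMod.χ₄_nat_three_mod_four (by omega),
      Int.sign_neg, Int.sign_eq_one_of_pos (by omega)]
    rfl
  · have : m = (k : ℤ) := by omega
    rw [this, hpos, Int.sign_eq_one_of_pos (by omega)]

theorem jacobiSym_four_mul (m : ℤ) {b : ℕ} (hb : b % 2 = 1) :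
    jacobiSym (4 * m) b = jacobiSym m b := by
  have h := jacobiSym.div_four_left (a := 4 * m) (b := b) (by omega) hb
  rw [Int.mul_ediv_cancel_left _ (by norm_num)] at h
  exact h.symm

theorem jacobiSym_congr_right {m : ℤ} {a b : ℕ} (ha : Odd a) (hb : Odd b)
    (h : a ≡ b [MOD 4 * m.natAbs]) : jacobiSym m a = jacobiSym m b := by
  rw [jacobiSym.mod_right m ha, jacobiSym.mod_right m hb, h]

/-- Here `a ≡ -b ≡ (4|m| - 1)b` modulo `4|m|`, and the extra factor contributes the sign of `m`. -/
theorem jacobiSym_of_add_dvd {m : ℤ} (hm : m ≠ 0) {a b : ℕ} (ha : Odd a) (hb : Odd b)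
    (h : 4 * m.natAbs ∣ a + b) : jacobiSym m a = m.sign * jacobiSym m b := by
  have hk0 : 0 < m.natAbs := Int.natAbs_pos.mpr hm
  rw [← jacobiSym_four_mul_sub_one hm, ← jacobiSym.mul_right' m (by omega) hb.pos.ne']
  have hodd : Odd (4 * m.natAbs - 1) := Nat.odd_iff.mpr (by omega)
  refine jacobiSym_congr_right ha (hodd.mul hb) ((Nat.modEq_iff_dvd).mpr ?_)
  obtain ⟨e, he⟩ := h
  refine ⟨b - e, ?_⟩
  have : (a : ℤ) + b = 4 * m.natAbs * e := by exact_mod_cast he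
  rw [Nat.cast_mul, Nat.cast_sub (by omega)]
  rw [Nat.cast_mul, Nat.cast_ofNat, Nat.cast_one]
  linear_combination -this

/-- With `c = 4m` the symbol is that of `m`, whose period in the lower entry divides `4|m| = |c|`.
The sign rule for negative `d` is what keeps this periodicity when `d` crosses zero. -/
theorem quadSymbol_add_mul {c d : ℤ} (hc : 4 ∣ c) (hd : d % 2 = 1) (k : ℤ) :
    quadSymbol c (d + k * c) = quadSymbol c d := by
  obtain ⟨m, rfl⟩ := hc
  rcases eq_or_ne m 0 with rfl | hm
  · rw [mul_zero, mul_zero, add_zero]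
  have hm4 : 4 * m ≠ 0 := by omega
  set e := d + k * (4 * m) with he
  have hed : e - d = 4 * m * k := by rw [he]; ring
  have he2 : e % 2 = 1 := by
    rw [he, show k * (4 * m) = 2 * (k * (2 * m)) by ring, Int.add_mul_emod_self_left, hd]
  have hs : (4 * m).sign = m.sign := by
    rw [Int.sign_mul, show (4 : ℤ).sign = 1 from rfl, one_mul]
  have hss : m.sign * m.sign = 1 := by
    rcases lt_or_gt_of_ne hm with h | h
    · simp [Int.sign_eq_neg_one_of_neg h]
    · simp [Int.sign_eq_one_of_pos h]
  have hmabs : ∀ x : ℤ, 4 * m ∣ x → ((4 * m.natAbs : ℕ) : ℤ) ∣ x := fun x hx => by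
    rw [Nat.cast_mul, Int.natCast_natAbs]
    have := (abs_dvd (4 * m) x).mpr hx
    rwa [abs_mul] at this
  have hdvd : 4 * m ∣ e - d := ⟨k, hed⟩
  clear_value e
  have odd_of : ∀ n : ℕ, ((n : ℤ) % 2 = 1 ∨ (-(n : ℤ)) % 2 = 1) → Odd n := fun n h =>
    Nat.odd_iff.mpr (by omega)
  have cast4 : ∀ n : ℕ, Odd n → jacobiSym (4 * m) n = jacobiSym m n := fun n h =>
    jacobiSym_four_mul m (Nat.odd_iff.mp h)
  obtain ⟨a, rfl | rfl⟩ := d.eq_nat_or_neg <;> obtain ⟨b, rfl | rfl⟩ := e.eq_nat_or_neg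
  · have ha := odd_of a (Or.inl hd)
    have hb := odd_of b (Or.inl he2)
    rw [quadSymbol_of_pos _ ha.pos, quadSymbol_of_pos _ hb.pos, cast4 _ ha, cast4 _ hb]
    exact (jacobiSym_congr_right ha hb (Nat.modEq_iff_dvd.mpr (hmabs _ hdvd))).symm
  · have ha := odd_of a (Or.inl hd)
    have hb := odd_of b (Or.inr he2)
    rw [quadSymbol_of_pos _ ha.pos, quadSymbol_of_neg hm4 hb.pos, cast4 _ ha, cast4 _ hb, hs]
    refine (jacobiSym_of_add_dvd hm ha hb ?_).symm
    have := hmabs _ ((dvd_neg).mpr hdvd)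
    rw [show -(-(b : ℤ) - a) = ((a + b : ℕ) : ℤ) by push_cast; ring] at this
    exact_mod_cast this
  · have ha := odd_of a (Or.inr hd)
    have hb := odd_of b (Or.inl he2)
    rw [quadSymbol_of_pos _ hb.pos, quadSymbol_of_neg hm4 ha.pos, cast4 _ ha, cast4 _ hb, hs]
    refine jacobiSym_of_add_dvd hm hb ha ?_
    have := hmabs _ hdvd
    rw [show (b : ℤ) - -a = ((b + a : ℕ) : ℤ) by push_cast; ring] at this
    exact_mod_cast this
  · have ha := odd_of a (Or.inr hd)
    have hb := odd_of b (Or.inr he2)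
    rw [quadSymbol_of_neg hm4 hb.pos, quadSymbol_of_neg hm4 ha.pos, cast4 _ ha, cast4 _ hb]
    congr 1
    refine jacobiSym_congr_right hb ha (Nat.modEq_iff_dvd.mpr (hmabs _ ?_))
    rwa [show (a : ℤ) - b = -b - -a by ring]

/-! ### The theta multiplier on `Γ₁(4)` -/

/-- `(c/d) √(cτ+d)`, the theta multiplier of a matrix in `Γ₁(4)` with bottom row `(c, d)`. -/
def rowMultiplier (c d : ℤ) (τ : ℂ) : ℂ := quadSymbol c d * (c * τ + d) ^ (1 / 2 : ℂ)

theorem rowMultiplier_add_mul {c d : ℤ} (hc : 4 ∣ c) (hd : d % 2 = 1) (k : ℤ) (τ : ℂ) :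
    rowMultiplier c (d + k * c) τ = rowMultiplier c d (τ + k) := by
  rw [rowMultiplier, rowMultiplier, quadSymbol_add_mul hc hd]
  congr 2
  push_cast
  ring

theorem im_mul_add (c d : ℤ) (τ : ℂ) : ((c : ℂ) * τ + d).im = c * τ.im := by
  simp

theorem mul_add_ne_zero {c d : ℤ} (h : IsCoprime c d) {τ : ℂ} (hτ : 0 < τ.im) :
    (c : ℂ) * τ + d ≠ 0 := by
  intro h0
  have h1 := congrArg Complex.im h0
  rw [im_mul_add, Complex.zero_im] at h1
  have hc : c = 0 := by
    rcases mul_eq_zero.mp h1 with h2 | h2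
    · exact_mod_cast h2
    · exact absurd h2 hτ.ne'
  subst hc
  have hd : d = 0 := by simpa using h0
  subst hd
  exact not_isCoprime_zero_zero h

theorem mem_slitPlane_mul_add {c d : ℤ} (hd : 0 < d) {τ : ℂ} (hτ : 0 < τ.im) :
    (c : ℂ) * τ + d ∈ Complex.slitPlane := by
  rw [Complex.mem_slitPlane_iff]
  rcases eq_or_ne c 0 with rfl | hc
  · left; simpa using hd
  · right
    rw [im_mul_add]
    exact mul_ne_zero (by exact_mod_cast hc) hτ.ne'

theorem im_div_mul_add (k : ℤ) {τ : ℂ} (hτ : 0 < τ.im) : 0 < (τ / (4 * k * τ + 1)).im := by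
  have h0 : (4 * k * τ + 1 : ℂ) ≠ 0 := by
    have := mul_add_ne_zero (c := 4 * k) (d := 1) isCoprime_one_right hτ
    push_cast at this
    exact this
  have hn : 0 < Complex.normSq (4 * k * τ + 1) := Complex.normSq_pos.mpr h0
  rw [Complex.div_im, ← sub_div]
  refine div_pos ?_ hn
  simp
  nlinarith

/-- The imaginary parts of the two factors and of their product have the signs of `k`, `c` and `c +
4kd`. If `kc > 0`, then `k(c + 4kd) > 0` because `d > 0`, so no branch is crossed. -/
theorem cpow_half_mul_add {c d : ℤ} (hd : 0 < d) (k : ℤ) {τ : ℂ} (hτ : 0 < τ.im) :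
    (((c + 4 * k * d : ℤ) : ℂ) * τ + d) ^ (1 / 2 : ℂ) =
      (4 * k * τ + 1) ^ (1 / 2 : ℂ) * (c * (τ / (4 * k * τ + 1)) + d) ^ (1 / 2 : ℂ) := by
  have hs := mem_slitPlane_mul_add (c := 4 * k) (d := 1) one_pos hτ
  have hi := im_mul_add (4 * k) 1 τ
  push_cast at hs hi
  have hx0 := Complex.slitPlane_ne_zero hs
  have hτ' := im_div_mul_add k hτ
  have hmul : (4 * k * τ + 1) * (c * (τ / (4 * k * τ + 1)) + d) =
      ((c + 4 * k * d : ℤ) : ℂ) * τ + d := by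
    push_cast
    field_simp
    ring
  rw [← hmul]
  refine cpow_half_mul_of_im hs (mem_slitPlane_mul_add hd hτ') ?_
  rw [hmul, im_mul_add, im_mul_add, hi]
  push_cast
  have hd' : (0 : ℝ) < d := by exact_mod_cast hd
  rcases le_or_gt ((k : ℝ) * c) 0 with h | h
  · left
    have : 0 ≤ τ.im * (τ / (4 * k * τ + 1)).im := by positivity
    nlinarith
  · right
    have h1 : 0 ≤ (k : ℝ) * k * d := mul_nonneg (mul_self_nonneg _) hd'.le
    have h2 : 0 < τ.im * τ.im := by positivity
    have h3 : 0 < ((k : ℝ) * c + 4 * (k * k * d)) * (τ.im * τ.im) := mul_pos (by linarith) h2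
    nlinarith

/-- The sign of `c` in the symbol cancels the sign in `√w = ±i√(-w)`, which reduces a negative lower
entry to a positive one. -/
theorem rowMultiplier_of_neg {c : ℤ} (hc : c ≠ 0) {n : ℕ} (hn : 0 < n) {τ : ℂ} (hτ : 0 < τ.im) :
    rowMultiplier c (-n) τ =
      Complex.I * (jacobiSym c n * (((-c : ℤ) : ℂ) * τ + (n : ℤ)) ^ (1 / 2 : ℂ)) := by
  rw [rowMultiplier, quadSymbol_of_neg hc hn]
  have hw : ((-c : ℤ) : ℂ) * τ + (n : ℤ) = -(c * τ + ((-n : ℤ) : ℂ)) := by push_cast; ring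
  rw [hw]
  rcases lt_or_gt_of_ne hc with h | h
  · rw [cpow_half_eq_neg_I_mul, Int.sign_eq_neg_one_of_neg h]
    · push_cast; ring
    · rw [im_mul_add]
      exact mul_neg_of_neg_of_pos (by exact_mod_cast h) hτ
  · rw [cpow_half_eq_I_mul, Int.sign_eq_one_of_pos h]
    · push_cast; ring
    · rw [im_mul_add]
      exact mul_pos (by exact_mod_cast h) hτ

theorem rowMultiplier_mul_add {c d : ℤ} (hd : d % 4 = 1) (hcd : IsCoprime c d)
    (k : ℤ) {τ : ℂ} (hτ : 0 < τ.im) :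
    rowMultiplier (c + 4 * k * d) d τ =
      (4 * k * τ + 1) ^ (1 / 2 : ℂ) * rowMultiplier c d (τ / (4 * k * τ + 1)) := by
  obtain ⟨n, rfl | rfl⟩ := d.eq_nat_or_neg
  · have hn : 0 < n := by omega
    rw [rowMultiplier, rowMultiplier, cpow_half_mul_add (by exact_mod_cast hn) k hτ,
      quadSymbol_of_pos _ hn, quadSymbol_of_pos _ hn,
      jacobiSym.mod_left' (a₁ := c + 4 * k * n) (a₂ := c) (by simp)]
    ring
  · have hn : 0 < n := by omega
    -- A negative `d ≡ 1 mod 4` is not `-1`, hence not a unit; coprimality then excludes a zero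
    -- lower-left entry, before and after the step.
    have hc : c ≠ 0 := by
      rintro rfl
      rw [isCoprime_zero_left, Int.isUnit_iff] at hcd
      omega
    have hc' : c + 4 * k * -(n : ℤ) ≠ 0 := by
      intro h
      have h1 : (n : ℤ) ∣ c := ⟨4 * k, by linarith⟩
      have h2 := hcd.isUnit_of_dvd' h1 ((dvd_neg).mpr dvd_rfl)
      rw [Int.isUnit_iff] at h2
      omega
    rw [rowMultiplier_of_neg hc' hn hτ, rowMultiplier_of_neg hc hn (im_div_mul_add k hτ),
      show -(c + 4 * k * -(n : ℤ)) = -c + 4 * k * n by ring,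
      cpow_half_mul_add (by exact_mod_cast hn) k hτ,
      jacobiSym.mod_left' (a₁ := c + 4 * k * -n) (a₂ := c) (by simp)]
    ring

/-! ### The transformation law of the Jacobi theta function under `Γ₁(4)` -/

theorem jacobiTheta₂_add_two_mul_int (z τ : ℂ) (k : ℤ) :
    jacobiTheta₂ z (τ + 2 * k) = jacobiTheta₂ z τ := by
  have h : Function.Periodic (jacobiTheta₂ z) 2 := jacobiTheta₂_add_right z
  simpa [mul_comm] using h.int_mul k τ

theorem im_two_mul_pos {τ : ℂ} (hτ : 0 < τ.im) : 0 < (2 * τ).im := by simpa using hτ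

/-- Conjugating by the functional equation turns `(1 0; 4k 1)` into a translation: for `τ' =
τ/(4kτ+1)`, `-1/(2τ') = -1/(2τ) - 2k`, and `2k` is a period. -/
theorem jacobiTheta₂_div_mul_add (k : ℤ) (z : ℂ) {τ : ℂ} (hτ : 0 < τ.im) :
    jacobiTheta₂ (z / (4 * k * τ + 1)) (2 * (τ / (4 * k * τ + 1))) =
      (4 * k * τ + 1) ^ (1 / 2 : ℂ) *
        Complex.exp (Real.pi * Complex.I * (4 * k) * z ^ 2 / (2 * (4 * k * τ + 1))) *
        jacobiTheta₂ z (2 * τ) := by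
  have hx0 : (4 * k * τ + 1 : ℂ) ≠ 0 := by
    have := mul_add_ne_zero (c := 4 * k) (d := 1) isCoprime_one_right hτ
    push_cast at this
    exact this
  have hτ0 : τ ≠ 0 := by rintro rfl; simp at hτ
  have hτ' := im_div_mul_add k hτ
  have hbranch := cpow_half_mul_of_re_pos (x := 4 * k * τ + 1)
    (y := -Complex.I * (2 * (τ / (4 * k * τ + 1)))) hx0 (by simpa using hτ') (by
      rw [show (4 * k * τ + 1 : ℂ) * (-Complex.I * (2 * (τ / (4 * k * τ + 1)))) =
        -Complex.I * (2 * τ) by field_simp]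
      simpa using hτ)
  rw [show (4 * k * τ + 1 : ℂ) * (-Complex.I * (2 * (τ / (4 * k * τ + 1)))) =
    -Complex.I * (2 * τ) by field_simp] at hbranch
  have hne : (4 * k * τ + 1 : ℂ) ^ (1 / 2 : ℂ) ≠ 0 := by
    simpa [Complex.cpow_eq_zero_iff] using hx0
  rw [jacobiTheta₂_functional_equation (z / (4 * k * τ + 1)),
    jacobiTheta₂_functional_equation z (2 * τ), hbranch]
  rw [show z / (4 * k * τ + 1) / (2 * (τ / (4 * k * τ + 1))) = z / (2 * τ) by field_simp,
    show -1 / (2 * (τ / (4 * k * τ + 1))) = -1 / (2 * τ) + 2 * ((-k : ℤ) : ℂ) by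
      push_cast; field_simp; ring,
    jacobiTheta₂_add_two_mul_int]
  have hexp : Complex.exp (-Real.pi * Complex.I * (z / (4 * k * τ + 1)) ^ 2 /
      (2 * (τ / (4 * k * τ + 1)))) =
      Complex.exp (Real.pi * Complex.I * (4 * k) * z ^ 2 / (2 * (4 * k * τ + 1))) *
        Complex.exp (-Real.pi * Complex.I * z ^ 2 / (2 * τ)) := by
    rw [← Complex.exp_add]
    congr 1
    field_simp
    ring
  rw [hexp]
  generalize (-Complex.I * (2 * (τ / (4 * k * τ + 1)))) ^ (1 / 2 : ℂ) = B
  generalize (4 * k * τ + 1 : ℂ) ^ (1 / 2 : ℂ) = A at hne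
  rw [one_div_mul_eq_div, one_div, mul_inv]
  field_simp

/-- The transformation law of `ϑ(z, 2τ)` under the matrix `(a b; c d)`. -/
def ThetaLaw (a b c d : ℤ) : Prop :=
  ∀ z τ : ℂ, 0 < τ.im →
    jacobiTheta₂ (z / (c * τ + d)) (2 * ((a * τ + b) / (c * τ + d))) =
      rowMultiplier c d τ * Complex.exp (Real.pi * Complex.I * c * z ^ 2 / (2 * (c * τ + d))) *
        jacobiTheta₂ z (2 * τ)

theorem ThetaLaw.mul_translation {a b c d : ℤ} (hc : 4 ∣ c) (hd : d % 2 = 1)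
    (h : ThetaLaw a b c d) (k : ℤ) : ThetaLaw a (b + k * a) c (d + k * c) := by
  intro z τ hτ
  have h1 := h z (τ + k) (by simpa using hτ)
  rw [rowMultiplier_add_mul hc hd, show (c : ℂ) * τ + (d + k * c : ℤ) = c * (τ + k) + d by
    push_cast; ring, show (a : ℂ) * τ + (b + k * a : ℤ) = a * (τ + k) + b by
    push_cast; ring, h1, mul_add 2 τ, jacobiTheta₂_add_two_mul_int]

theorem ThetaLaw.mul_lower {a b c d : ℤ} (hdet : a * d - b * c = 1) (hd : d % 4 = 1)
    (h : ThetaLaw a b c d) (k : ℤ) : ThetaLaw (a + 4 * k * b) b (c + 4 * k * d) d := by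
  intro z τ hτ
  have hcd : IsCoprime c d := ⟨-b, a, by linarith⟩
  have hcd' : IsCoprime (c + 4 * k * d) d := ⟨-b, a + 4 * k * b, by linarith⟩
  have hτ' := im_div_mul_add k hτ
  have hx0 : (4 * k * τ + 1 : ℂ) ≠ 0 := by
    have := mul_add_ne_zero (c := 4 * k) (d := 1) isCoprime_one_right hτ
    push_cast at this
    exact this
  have hD := mul_add_ne_zero hcd' hτ
  have h1 := h (z / (4 * k * τ + 1)) (τ / (4 * k * τ + 1)) hτ'
  rw [jacobiTheta₂_div_mul_add k z hτ] at h1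
  rw [rowMultiplier_mul_add hd hcd k hτ]
  have e1 : (c : ℂ) * (τ / (4 * k * τ + 1)) + d =
      ((c + 4 * k * d : ℤ) * τ + d) / (4 * k * τ + 1) := by
    rw [eq_div_iff hx0]
    push_cast
    linear_combination c * div_mul_cancel₀ τ hx0
  have e2 : (a : ℂ) * (τ / (4 * k * τ + 1)) + b =
      ((a + 4 * k * b : ℤ) * τ + b) / (4 * k * τ + 1) := by
    rw [eq_div_iff hx0]
    push_cast
    linear_combination a * div_mul_cancel₀ τ hx0
  rw [e1, e2, div_div_div_cancel_right₀ hx0, div_div_div_cancel_right₀ hx0] at h1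
  rw [h1]
  have hexp : Complex.exp (Real.pi * Complex.I * (c + 4 * k * d : ℤ) * z ^ 2 /
      (2 * ((c + 4 * k * d : ℤ) * τ + d))) =
      Complex.exp (Real.pi * Complex.I * c * (z / (4 * k * τ + 1)) ^ 2 /
        (2 * (((c + 4 * k * d : ℤ) * τ + d) / (4 * k * τ + 1)))) *
      Complex.exp (Real.pi * Complex.I * (4 * k) * z ^ 2 / (2 * (4 * k * τ + 1))) := by
    rw [← Complex.exp_add]
    congr 1
    push_cast at hD ⊢
    field_simp
    ring
  rw [hexp]
  ring

theorem exists_two_mul_abs_sub_le (x : ℤ) {m : ℤ} (hm : m ≠ 0) :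
    ∃ k : ℤ, 2 * |x + k * m| ≤ |m| := by
  have key (M : ℤ) (hM : 0 < M) : ∃ k : ℤ, 2 * |x + k * M| ≤ M := by
    -- The quotient is `x / M` rounded to a nearest integer.
    refine ⟨-((2 * x + M) / (2 * M)), ?_⟩
    have h1 := Int.emod_add_mul_ediv (2 * x + M) (2 * M)
    have h2 := Int.emod_nonneg (2 * x + M) (b := 2 * M) (by omega)
    have h3 := Int.emod_lt_of_pos (2 * x + M) (b := 2 * M) (by omega)
    generalize (2 * x + M) / (2 * M) = q at *
    have h4 : |2 * (x + -q * M)| ≤ M := abs_le.mpr ⟨by linarith, by linarith⟩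
    rwa [abs_mul, abs_two] at h4
  obtain ⟨k, hk⟩ := key |m| (abs_pos.mpr hm)
  rcases abs_choice m with h | h
  · exact ⟨k, by rwa [h] at hk ⊢⟩
  · refine ⟨-k, ?_⟩
    rw [h] at hk ⊢
    rwa [show x + -k * m = x + k * -m by ring]

/-- Descent on `|c|`: reduce `d` modulo `c`, then `c` modulo `4d₁`. Both reductions are right
multiplications for which the law is known, and they are undone at the end. -/
theorem thetaLaw {a b c d : ℤ} (hdet : a * d - b * c = 1) (hc : 4 ∣ c) (hd : d % 4 = 1) :
    ThetaLaw a b c d := by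
  induction hn : c.natAbs using Nat.strong_induction_on generalizing a b c d with
  | _ n ih =>
  rcases eq_or_ne c 0 with rfl | hc0
  · have h1 : a * d = 1 := by linarith
    have hd1 : d = 1 := by
      have := Int.isUnit_iff.mp (.of_mul_eq_one a (by linarith : d * a = 1))
      omega
    subst hd1
    have ha1 : a = 1 := by linarith
    subst ha1
    intro z τ hτ
    have := jacobiTheta₂_add_two_mul_int z (2 * τ) b
    simpa [rowMultiplier, quadSymbol, mul_add] using this
  · obtain ⟨k, hk⟩ := exists_two_mul_abs_sub_le d hc0
    set d₁ := d + k * c with hd₁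
    have hd₁4 : d₁ % 4 = 1 := by
      obtain ⟨m, rfl⟩ := hc
      rw [hd₁, show k * (4 * m) = 4 * (k * m) by ring, Int.add_mul_emod_self_left, hd]
    obtain ⟨l, hl⟩ := exists_two_mul_abs_sub_le c (m := 4 * d₁) (by omega)
    set c₁ := c + l * (4 * d₁) with hc₁
    -- One has `|c₁| ≤ 2|d₁| ≤ |c|`, and the last inequality is strict because `d₁` is odd while `4
    -- ∣ c`.
    have hlt : c₁.natAbs < n := by
      clear_value c₁ d₁
      simp only [Int.abs_eq_natAbs] at hk hl
      omega
    have hc₁4 : 4 ∣ c₁ := hc.add ⟨l * d₁, by ring⟩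
    have hdet' : (a + 4 * l * (b + k * a)) * d₁ - (b + k * a) * c₁ = 1 := by
      rw [hc₁, hd₁]; linear_combination hdet
    have h1 := (ih _ hlt hdet' hc₁4 hd₁4 rfl).mul_lower hdet' hd₁4 (-l)
    rw [show c₁ + 4 * -l * d₁ = c by rw [hc₁]; ring,
      show a + 4 * l * (b + k * a) + 4 * -l * (b + k * a) = a by ring] at h1
    have h2 := h1.mul_translation hc (by omega) (-k)
    rwa [show d₁ + -k * c = d by rw [hd₁]; ring, show b + k * a + -k * a = b by ring] at h2

/-! ### Theta series of residue classes -/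

/-- The summand of `residueTheta`. -/
def residueTerm (N : ℕ) (r : ZMod N) (τ : ℂ) (x : ℤ) : ℂ :=
  if (x : ZMod N) = r then Complex.exp (2 * Real.pi * Complex.I * x ^ 2 * τ) else 0

/-- The theta series `∑_{x ≡ r mod N} e^{2πi x² τ}`. -/
def residueTheta (N : ℕ) (r : ZMod N) (τ : ℂ) : ℂ := ∑' x : ℤ, residueTerm N r τ x

theorem summable_residueTerm (N : ℕ) (r : ZMod N) {τ : ℂ} (hτ : 0 < τ.im) :
    Summable (residueTerm N r τ) := by
  have h := ((summable_jacobiTheta₂_term_iff 0 (2 * τ)).mpr (im_two_mul_pos hτ)).norm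
  refine Summable.of_norm_bounded h fun x => ?_
  rw [residueTerm]
  split_ifs
  · refine le_of_eq ?_
    rw [jacobiTheta₂_term]
    congr 2
    ring
  · simp

theorem stdAddChar_mul_intCast {N : ℕ} [NeZero N] (j : ZMod N) (x : ℤ) :
    ZMod.stdAddChar (j * (x : ZMod N)) =
      Complex.exp (2 * Real.pi * Complex.I * x * ((j.val : ℤ) / N)) := by
  have h : j * (x : ZMod N) = (((j.val : ℤ) * x : ℤ) : ZMod N) := by
    push_cast
    rw [ZMod.natCast_zmod_val]
  rw [h, ZMod.stdAddChar_coe]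
  congr 1
  push_cast
  ring

/-- Orthogonality of additive characters detects `x ≡ r`, and the character `e^{2πijx/N}` is
absorbed as the elliptic variable `z = j/N`. -/
theorem residueTheta_eq (N : ℕ) [NeZero N] (r : ZMod N) {τ : ℂ} (hτ : 0 < τ.im) :
    residueTheta N r τ = (N : ℂ)⁻¹ * ∑ j : ZMod N, ZMod.stdAddChar (-(j * r)) *
      jacobiTheta₂ ((j.val : ℤ) / N) (2 * τ) := by
  have hN : (N : ℂ) ≠ 0 := by exact_mod_cast NeZero.ne N
  have hterm (x : ℤ) : residueTerm N r τ x = (N : ℂ)⁻¹ * ∑ j : ZMod N,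
      ZMod.stdAddChar (-(j * r)) * jacobiTheta₂_term x ((j.val : ℤ) / N) (2 * τ) := by
    have h1 (j : ZMod N) : ZMod.stdAddChar (-(j * r)) *
        jacobiTheta₂_term x ((j.val : ℤ) / N) (2 * τ) =
        ZMod.stdAddChar (j * ((x : ZMod N) - r)) *
          Complex.exp (2 * Real.pi * Complex.I * x ^ 2 * τ) := by
      rw [mul_sub, sub_eq_neg_add, AddChar.map_add_eq_mul, stdAddChar_mul_intCast, mul_assoc,
        ← Complex.exp_add, jacobiTheta₂_term]
      congr 2
      ring
    simp_rw [h1]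
    rw [← Finset.sum_mul, AddChar.sum_mulShift _ (ZMod.isPrimitive_stdAddChar N), residueTerm]
    simp only [sub_eq_zero, ZMod.card]
    split_ifs
    · rw [inv_mul_cancel_left₀ hN]
    · simp
  rw [residueTheta]
  simp_rw [hterm]
  rw [tsum_mul_left, Summable.tsum_finsetSum]
  · simp_rw [tsum_mul_left]
    rfl
  · intro j _
    exact ((summable_jacobiTheta₂_term_iff _ _).mpr (im_two_mul_pos hτ)).mul_left _

theorem differentiableAt_residueTheta (N : ℕ) [NeZero N] (r : ZMod N) {τ : ℂ} (hτ : 0 < τ.im) :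
    DifferentiableAt ℂ (residueTheta N r) τ := by
  have h : (fun τ => (N : ℂ)⁻¹ * ∑ j : ZMod N, ZMod.stdAddChar (-(j * r)) *
      jacobiTheta₂ ((j.val : ℤ) / N) (2 * τ)) =ᶠ[nhds τ] residueTheta N r := by
    filter_upwards [(isOpen_lt continuous_const Complex.continuous_im).mem_nhds hτ] with w hw
    exact (residueTheta_eq N r hw).symm
  refine DifferentiableAt.congr_of_eventuallyEq ?_ h.symm
  refine DifferentiableAt.const_mul (DifferentiableAt.fun_sum fun j _ => ?_) _
  refine DifferentiableAt.const_mul ?_ _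
  exact (differentiableAt_jacobiTheta₂_snd _ (im_two_mul_pos hτ)).comp τ
    (differentiableAt_id.const_mul 2)

theorem jacobiTheta₂_add_int (z τ : ℂ) (k : ℤ) :
    jacobiTheta₂ (z + k) τ = jacobiTheta₂ z τ := by
  have h : Function.Periodic (jacobiTheta₂ · τ) 1 := fun z => jacobiTheta₂_add_left z τ
  simpa using h.int_mul k z

theorem jacobiTheta₂_add_int_mul (z τ : ℂ) (n : ℤ) :
    jacobiTheta₂ (z + n * τ) τ =
      Complex.exp (-(Real.pi * Complex.I * n ^ 2 * τ + 2 * Real.pi * Complex.I * n * z)) *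
        jacobiTheta₂ z τ := by
  conv_rhs => rw [jacobiTheta₂, ← tsum_mul_left, ← (Equiv.addRight n).tsum_eq]
  refine tsum_congr fun k => ?_
  simp only [jacobiTheta₂_term, Equiv.coe_addRight]
  rw [← Complex.exp_add]
  congr 1
  push_cast
  ring

theorem residueTheta_transform (N : ℕ) [NeZero N] (r : ZMod N) {a b c d : ℤ}
    (hdet : a * d - b * c = 1) (hc : 4 * (N : ℤ) ^ 2 ∣ c) (hd : d % 4 = 1) (hdN : (N : ℤ) ∣ d - 1)
    {τ : ℂ} (hτ : 0 < τ.im) (hτ' : 0 < ((a * τ + b) / (c * τ + d) : ℂ).im) :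
    residueTheta N r ((a * τ + b) / (c * τ + d)) =
      rowMultiplier c d τ * residueTheta N r τ := by
  have hD := mul_add_ne_zero (c := c) (d := d) ⟨-b, a, by linarith⟩ hτ
  have hN : (N : ℂ) ≠ 0 := by exact_mod_cast NeZero.ne N
  rw [residueTheta_eq N r hτ', residueTheta_eq N r hτ, mul_left_comm]
  congr 1
  rw [Finset.mul_sum]
  refine Finset.sum_congr rfl fun j _ => ?_
  rw [mul_left_comm]
  congr 1
  generalize (j.val : ℤ) = m
  have h := thetaLaw hdet ((dvd_mul_right 4 ((N : ℤ) ^ 2)).trans hc) hd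
    ((m : ℂ) / N * (c * τ + d)) τ hτ
  rw [mul_div_cancel_right₀ _ hD] at h
  rw [h, mul_assoc]
  congr 1
  obtain ⟨c', rfl⟩ := hc
  obtain ⟨d', hd'⟩ := hdN
  obtain rfl : d = 1 + N * d' := by linarith
  -- The elliptic variable is `m/N` modulo the lattice `ℤ + ℤ·2τ`, by the congruences on `c` and
  -- `d`.
  have hz : (m : ℂ) / N * (((4 * (N : ℤ) ^ 2 * c' : ℤ) : ℂ) * τ + ((1 + N * d' : ℤ) : ℂ)) =
      m / N + (m * d' : ℤ) + (2 * N * m * c' : ℤ) * (2 * τ) := by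
    push_cast
    field_simp
    ring
  rw [hz, jacobiTheta₂_add_int_mul, jacobiTheta₂_add_int, ← mul_assoc, ← Complex.exp_add]
  rw [← hz]
  convert one_mul _ using 2
  rw [Complex.exp_eq_one_iff]
  -- The `τ`-terms of the automorphy and quasi-periodicity exponents cancel; this is what remains
  -- after division by `2πi`, integral because `4N² ∣ c`.
  refine ⟨c' * m ^ 2 * (1 + N * d') - 2 * N * m * c' * (m * d') - 2 * c' * m ^ 2, ?_⟩
  push_cast at hD ⊢
  field_simp
  ring

/-! ### Expansions in powers of `e^{2πiτ/m}` -/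

/-- `ψ` has an expansion `∑_{n ≥ 0} a_n e^{2πinτ/m}` for the given `m`. -/
def HasExpansion (m : ℕ) (ψ : ℍ → ℂ) : Prop :=
  ∃ a : ℕ → ℂ, ∀ τ : ℍ,
    HasSum (fun n : ℕ => a n * Complex.exp (2 * Real.pi * Complex.I * (τ : ℂ) / m) ^ n) (ψ τ)

theorem HasExpansion.isHolomorphicAtInfinity {m : ℕ} (hm : 0 < m) {ψ : ℍ → ℂ}
    (h : HasExpansion m ψ) : IsHolomorphicAtInfinity ψ := ⟨m, hm, h⟩

theorem hasExpansion_const (m : ℕ) (c : ℂ) : HasExpansion m fun _ => c := by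
  refine ⟨fun n => if n = 0 then c else 0, fun τ => ?_⟩
  convert hasSum_ite_eq (0 : ℕ) c using 2 with n
  split_ifs with h <;> simp [h]

theorem HasExpansion.mul {m : ℕ} {ψ φ : ℍ → ℂ} (hψ : HasExpansion m ψ) (hφ : HasExpansion m φ) :
    HasExpansion m fun τ => ψ τ * φ τ := by
  obtain ⟨a, ha⟩ := hψ
  obtain ⟨b, hb⟩ := hφ
  refine ⟨fun n => ∑ kl ∈ Finset.HasAntidiagonal.antidiagonal n, a kl.1 * b kl.2, fun τ => ?_⟩
  have ha' := (ha τ).summable.norm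
  have hb' := (hb τ).summable.norm
  have h := (summable_norm_sum_mul_antidiagonal_of_summable_norm ha' hb').of_norm.hasSum
  rw [← tsum_mul_tsum_eq_tsum_sum_antidiagonal_of_summable_norm ha' hb', (ha τ).tsum_eq,
    (hb τ).tsum_eq] at h
  refine Eq.mpr (congrArg (HasSum · _) (funext fun n => ?_)) h
  rw [Finset.sum_mul]
  refine Finset.sum_congr rfl fun kl hkl => ?_
  rw [← Finset.HasAntidiagonal.mem_antidiagonal.mp hkl, pow_add]
  ring

theorem HasExpansion.const_mul {m : ℕ} {ψ : ℍ → ℂ} (c : ℂ) (hψ : HasExpansion m ψ) :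
    HasExpansion m fun τ => c * ψ τ := (hasExpansion_const m c).mul hψ

theorem HasExpansion.sum {m : ℕ} {ι : Type*} {ψ : ι → ℍ → ℂ} {s : Finset ι}
    (h : ∀ i ∈ s, HasExpansion m (ψ i)) : HasExpansion m fun τ => ∑ i ∈ s, ψ i τ := by
  choose! a ha using h
  refine ⟨fun n => ∑ i ∈ s, a i n, fun τ => ?_⟩
  simp_rw [Finset.sum_mul]
  exact hasSum_sum fun i hi => ha i hi τ

theorem HasExpansion.prod {m : ℕ} {ι : Type*} {ψ : ι → ℍ → ℂ} {s : Finset ι}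
    (h : ∀ i ∈ s, HasExpansion m (ψ i)) : HasExpansion m fun τ => ∏ i ∈ s, ψ i τ := by
  classical
  induction s using Finset.induction_on with
  | empty => simpa using hasExpansion_const m 1
  | insert i s hi ih =>
    simp_rw [Finset.prod_insert hi]
    exact (h i (Finset.mem_insert_self i s)).mul
      (ih fun j hj => h j (Finset.mem_insert_of_mem hj))

/-- Collects a series over lattice points by exponent, the fibres being finite. -/
theorem hasSum_pow_of_fiber {ι : Type*} {g : ι → ℕ} {F : ℕ → Finset ι}
    (hF : ∀ n i, i ∈ F n ↔ g i = n) {c : ι → ℂ} {q S : ℂ}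
    (h : HasSum (fun i => c i * q ^ g i) S) :
    HasSum (fun n => (∑ i ∈ F n, c i) * q ^ n) S := by
  have h1 := (Equiv.sigmaFiberEquiv g).hasSum_iff.mpr h
  refine h1.sigma fun n => ?_
  have h2 := (F n).hasSum (fun i => c i * q ^ g i)
  have h3 := (Equiv.subtypeEquivRight (fun i => (hF n i).symm)).hasSum_iff.mpr h2
  rw [Finset.sum_mul, Finset.sum_congr rfl fun i hi => by rw [← (hF n i).mp hi]]
  exact h3

/-! ### The behaviour of `residueTheta` under `τ ↦ -1/τ` -/

/-- The functional equation at `(zτ/2, τ/2)`, solved for the other side. The factor `√(-iτ)` does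
not depend on `z`, so it comes out of the Fourier sum. -/
theorem jacobiTheta₂_neg_two_div (z : ℂ) {τ : ℂ} (hτ : 0 < τ.im) :
    jacobiTheta₂ z (2 * (-1 / τ)) = (1 / 2 : ℂ) ^ (1 / 2 : ℂ) * (-Complex.I * τ) ^ (1 / 2 : ℂ) *
      (Complex.exp (Real.pi * Complex.I * z ^ 2 * τ / 2) *
        jacobiTheta₂ (z * τ / 2) (τ / 2)) := by
  have hτ0 : τ ≠ 0 := by rintro rfl; simp at hτ
  have hbranch := cpow_half_mul_of_re_pos (x := 1 / 2) (y := -Complex.I * τ) (by norm_num)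
    (by simpa using hτ) (by simpa using hτ)
  have hne : (1 / 2 * (-Complex.I * τ) : ℂ) ^ (1 / 2 : ℂ) ≠ 0 := by
    simpa [Complex.cpow_eq_zero_iff] using hτ0
  rw [← hbranch, jacobiTheta₂_functional_equation (z * τ / 2),
    show -Complex.I * (τ / 2) = 1 / 2 * (-Complex.I * τ) by ring,
    show z * τ / 2 / (τ / 2) = z by field_simp, show -1 / (τ / 2) = 2 * (-1 / τ) by field_simp,
    show -(Real.pi : ℂ) * Complex.I * (z * τ / 2) ^ 2 / (τ / 2) =
      -(Real.pi * Complex.I * z ^ 2 * τ / 2) by field_simp, Complex.exp_neg]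
  have hE := Complex.exp_ne_zero (Real.pi * Complex.I * z ^ 2 * τ / 2)
  generalize Complex.exp (Real.pi * Complex.I * z ^ 2 * τ / 2) = E at hE
  generalize (1 / 2 * (-Complex.I * τ) : ℂ) ^ (1 / 2 : ℂ) = B at hne
  field_simp

theorem finite_natAbs_sq_eq (M : ℕ) [NeZero M] (j : ℤ) (n : ℕ) :
    {k : ℤ | (k * M + j).natAbs ^ 2 = n}.Finite := by
  have hM : (M : ℤ) ≠ 0 := by exact_mod_cast NeZero.ne M
  have hinj : Function.Injective fun k : ℤ => k * M + j := fun k l h => by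
    exact mul_right_cancel₀ hM (add_right_cancel h)
  refine ((Set.finite_Icc (-(n : ℤ)) n).preimage hinj.injOn).subset fun k hk => ?_
  have h1 : (k * M + j).natAbs ≤ n := by
    have h2 : (k * M + j).natAbs ^ 2 = n := hk
    rw [← h2]
    exact Nat.le_self_pow two_ne_zero _
  simp only [Set.mem_preimage, Set.mem_Icc]
  omega

/-- Completing the square makes the `k`-th term `e^{πi(k + j/M)²τ/2} = q^{(kM+j)²}` with `q =
e^{2πiτ/(4M²)}`; no exponent is negative. -/
theorem hasExpansion_jacobiTheta₂ (M : ℕ) [NeZero M] (j : ℤ) :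
    HasExpansion (4 * M ^ 2) fun τ : ℍ =>
      Complex.exp (Real.pi * Complex.I * (j / M : ℂ) ^ 2 * τ / 2) *
        jacobiTheta₂ ((j / M : ℂ) * τ / 2) (τ / 2) := by
  have hM : (M : ℂ) ≠ 0 := by exact_mod_cast NeZero.ne M
  refine ⟨fun n => ∑ k ∈ (finite_natAbs_sq_eq M j n).toFinset, 1, fun τ => ?_⟩
  refine hasSum_pow_of_fiber (g := fun k : ℤ => (k * M + j).natAbs ^ 2) (c := fun _ => 1)
    (fun n k => by simp) ?_
  have h := (hasSum_jacobiTheta₂_term ((j / M : ℂ) * τ / 2) (τ := (τ : ℂ) / 2)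
    (by simpa using τ.im_pos)).mul_left
    (Complex.exp (Real.pi * Complex.I * (j / M : ℂ) ^ 2 * τ / 2))
  refine Eq.mpr (congrArg (HasSum · _) (funext fun k => ?_)) h
  rw [one_mul, jacobiTheta₂_term, ← Complex.exp_add, ← Complex.exp_nat_mul]
  congr 1
  have : (((k * M + j).natAbs ^ 2 : ℕ) : ℂ) = (k * M + j : ℂ) ^ 2 := by
    have : (((k * M + j).natAbs ^ 2 : ℕ) : ℤ) = (k * M + j) ^ 2 := by simp
    rw [← Int.cast_natCast, this]
    push_cast
    rfl
  rw [this]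
  push_cast
  field_simp
  ring

theorem hasExpansion_residueTheta (M : ℕ) [NeZero M] (r : ZMod M) :
    HasExpansion (4 * M ^ 2) fun τ : ℍ =>
      ((-Complex.I * τ) ^ (1 / 2 : ℂ))⁻¹ * residueTheta M r (-1 / τ) := by
  have key (τ : ℍ) : ((-Complex.I * τ) ^ (1 / 2 : ℂ))⁻¹ * residueTheta M r (-1 / τ) =
      ((M : ℂ)⁻¹ * (1 / 2 : ℂ) ^ (1 / 2 : ℂ)) * ∑ j : ZMod M, ZMod.stdAddChar (-(j * r)) *
        (Complex.exp (Real.pi * Complex.I * (((j.val : ℤ) : ℂ) / M : ℂ) ^ 2 * τ / 2) *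
        jacobiTheta₂ ((((j.val : ℤ) : ℂ) / M : ℂ) * τ / 2) (τ / 2)) := by
    have hne : (-Complex.I * τ : ℂ) ^ (1 / 2 : ℂ) ≠ 0 := by
      simp [Complex.cpow_eq_zero_iff, UpperHalfPlane.ne_zero τ]
    have him : 0 < (-1 / (τ : ℂ)).im := by
      rw [neg_div, one_div, ← inv_neg]
      exact τ.im_inv_neg_coe_pos
    rw [residueTheta_eq M r him]
    simp_rw [jacobiTheta₂_neg_two_div _ τ.im_pos]
    rw [Finset.mul_sum, Finset.mul_sum, Finset.mul_sum]
    refine Finset.sum_congr rfl fun j _ => ?_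
    generalize (-Complex.I * τ : ℂ) ^ (1 / 2 : ℂ) = B at hne
    field_simp
  simp_rw [key]
  exact (HasExpansion.sum fun j _ => (hasExpansion_jacobiTheta₂ M j.val).const_mul _).const_mul _

/-! ### Weighted theta functions as sums of products of one-dimensional theta series -/

theorem hasSum_prod_of_summable {d : ℕ} {g : Fin d → ℤ → ℂ} (h : ∀ i, Summable (g i)) :
    HasSum (fun x : Fin d → ℤ => ∏ i, g i (x i)) (∏ i, ∑' n, g i n) := by
  induction d with
  | zero => simp only [Finset.univ_eq_empty, Finset.prod_empty]; exact hasSum_unique _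
  | succ d ih =>
    have h1 := ih (g := fun i => g i.succ) fun i => h i.succ
    have h2 := (h 0).hasSum.mul h1
      (summable_mul_of_summable_norm (f := g 0)
        (g := fun x : Fin d → ℤ => ∏ i : Fin d, g i.succ (x i)) (h 0).norm h1.summable.norm)
    rw [Fin.prod_univ_succ]
    refine (Fin.consEquiv fun _ => ℤ).hasSum_iff.mp ?_
    have h3 : (fun x : Fin (d + 1) → ℤ => ∏ i, g i (x i)) ∘ (Fin.consEquiv fun _ => ℤ) =
        fun x : ℤ × (Fin d → ℤ) => g 0 x.1 * ∏ i : Fin d, g i.succ (x.2 i) := by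
      funext x
      simp [Fin.consEquiv, Fin.prod_univ_succ]
    rw [h3]
    exact h2

theorem thetaTerm_eq {d p : ℕ} [NeZero p] (f : (Fin d → ZMod p) → ℂ) (τ : ℍ) (x : Fin d → ℤ) :
    thetaTerm f τ x = ∑ r, f r * ∏ i, residueTerm p (r i) τ (x i) := by
  rw [Finset.sum_eq_single (reduce p x)]
  · rw [thetaTerm]
    congr 1
    simp only [residueTerm, reduce, if_true]
    rw [← Complex.exp_sum, quadForm]
    congr 1
    push_cast
    rw [Finset.mul_sum, Finset.sum_mul]
    exact Finset.sum_congr rfl fun i _ => by ring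
  · intro r _ hr
    obtain ⟨i, hi⟩ := Function.ne_iff.mp hr
    rw [Finset.prod_eq_zero (Finset.mem_univ i), mul_zero]
    exact if_neg fun h => hi h.symm
  · intro h
    exact absurd (Finset.mem_univ _) h

theorem hasSum_thetaTerm {d p : ℕ} [NeZero p] (f : (Fin d → ZMod p) → ℂ) (τ : ℍ) :
    HasSum (thetaTerm f τ) (∑ r, f r * ∏ i, residueTheta p (r i) τ) := by
  have h : thetaTerm f τ = fun x => ∑ r, f r * ∏ i, residueTerm p (r i) τ (x i) :=
    funext (thetaTerm_eq f τ)
  rw [h]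
  exact hasSum_sum fun r _ =>
    (hasSum_prod_of_summable fun i => summable_residueTerm p (r i) τ.im_pos).mul_left _

theorem weightedTheta_eq {d p : ℕ} [NeZero p] (f : (Fin d → ZMod p) → ℂ) (τ : ℍ) :
    weightedTheta f τ = ∑ r, f r * ∏ i, residueTheta p (r i) τ :=
  (hasSum_thetaTerm f τ).tsum_eq

theorem hasSum_thetaCoeff {d p : ℕ} [NeZero p] (f : (Fin d → ZMod p) → ℂ) (τ : ℍ) :
    HasSum (fun n : ℕ => thetaCoeff f n * Complex.exp (2 * Real.pi * Complex.I * (τ : ℂ)) ^ n)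
      (weightedTheta f τ) := by
  have hnn (x : Fin d → ℤ) : 0 ≤ quadForm x := Finset.sum_nonneg fun i _ => mul_self_nonneg _
  refine hasSum_pow_of_fiber (g := fun x => (quadForm x).toNat) (c := fun x => f (reduce p x))
    (fun n x => ?_) ?_
  · have := hnn x
    rw [Set.Finite.mem_toFinset, quadric, Set.mem_ofPred_eq]
    omega
  · refine Eq.mpr (congrArg (HasSum · _) (funext fun x => ?_))
      (hasSum_thetaTerm f τ).summable.hasSum
    rw [thetaTerm, ← Complex.exp_nat_mul]
    congr 2
    have h : (((quadForm x).toNat : ℕ) : ℂ) = (quadForm x : ℂ) := by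
      rw [← Int.cast_natCast, Int.toNat_of_nonneg (hnn x)]
    rw [h]
    ring

theorem mdifferentiable_weightedTheta {d p : ℕ} [NeZero p] (f : (Fin d → ZMod p) → ℂ) :
    MDiff (weightedTheta f) := by
  rw [UpperHalfPlane.mdifferentiable_iff]
  have h : DifferentiableOn ℂ (fun z => ∑ r, f r * ∏ i, residueTheta p (r i) z)
      {z : ℂ | 0 < z.im} := fun z hz => by
    refine DifferentiableAt.differentiableWithinAt ?_
    refine DifferentiableAt.fun_sum fun r _ => DifferentiableAt.const_mul ?_ _
    exact DifferentiableAt.fun_finsetProd fun i _ => differentiableAt_residueTheta p (r i) hz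
  refine h.congr fun z hz => ?_
  rw [Function.comp_apply, weightedTheta_eq, ofComplex_apply_of_im_pos hz]

/-! ### Weak modularity -/

theorem quadSymbol_ne_zero {c d : ℤ} (h : IsCoprime c d) :
    quadSymbol c d ≠ 0 := by
  rcases eq_or_ne c 0 with rfl | hc
  · rw [isCoprime_zero_left, Int.isUnit_iff] at h
    simp [quadSymbol, h]
  · have hJ : ∀ n : ℕ, n = d.natAbs → jacobiSym c n ≠ 0 := by
      rintro _ rfl
      refine jacobiSym.ne_zero ?_
      simpa [Int.gcd, Int.natAbs_abs] using Int.isCoprime_iff_gcd_eq_one.mp h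
    rw [quadSymbol, if_neg hc]
    split_ifs
    · exact mul_ne_zero (by simpa [Int.sign_eq_zero_iff_zero] using hc) (hJ _ rfl)
    · exact hJ _ rfl

theorem thetaMultiplier_eq {g : SL(2, ℤ)} (hg : g 1 1 % 4 = 1) (τ : ℍ) :
    thetaMultiplier g τ = rowMultiplier (g 1 0) (g 1 1) τ := by
  rw [thetaMultiplier, rowMultiplier, epsilonFactor, if_pos hg, inv_one, one_mul]

theorem rowMultiplier_ne_zero {c d : ℤ} (h : IsCoprime c d) {τ : ℂ}
    (hτ : 0 < τ.im) : rowMultiplier c d τ ≠ 0 := by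
  rw [rowMultiplier]
  refine mul_ne_zero (by exact_mod_cast quadSymbol_ne_zero h) ?_
  rw [Ne, Complex.cpow_eq_zero_iff]
  exact fun h0 => mul_add_ne_zero h hτ h0.1

theorem isWeaklyModular_weightedTheta {d p : ℕ} [NeZero p] (f : (Fin d → ZMod p) → ℂ)
    {Γ : Subgroup SL(2, ℤ)} (hΓ : ∀ g ∈ Γ, g 1 1 % 4 = 1 ∧ (p : ℤ) ∣ g 1 1 - 1 ∧
      4 * (p : ℤ) ^ 2 ∣ g 1 0) : IsWeaklyModular d Γ (weightedTheta f) := by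
  intro g hg τ
  obtain ⟨h1, h2, h3⟩ := hΓ g⁻¹ (Γ.inv_mem hg)
  generalize g⁻¹ = γ at *
  have hdet : γ 0 0 * γ 1 1 - γ 0 1 * γ 1 0 = 1 := by
    rw [← Matrix.det_fin_two]; exact γ.det_coe
  have hcop : IsCoprime (γ 1 0) (γ 1 1) := ⟨-γ 0 1, γ 0 0, by linarith⟩
  have hcoe : ((γ • τ : ℍ) : ℂ) = (γ 0 0 * τ + γ 0 1) / (γ 1 0 * τ + γ 1 1) := by
    rw [UpperHalfPlane.coe_specialLinearGroup_apply]
    simp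
  have hne := rowMultiplier_ne_zero hcop τ.im_pos
  rw [weightedTheta_eq, weightedTheta_eq, thetaMultiplier_eq h1, hcoe, Finset.mul_sum]
  refine Finset.sum_congr rfl fun r _ => ?_
  simp_rw [residueTheta_transform p _ hdet h3 h1 h2 τ.im_pos (hcoe ▸ (γ • τ).im_pos)]
  rw [Finset.prod_mul_distrib, Finset.prod_const, Finset.card_univ, Fintype.card_fin,
    _root_.zpow_neg, zpow_natCast]
  field_simp

/-! ### Behaviour at the rational cusps -/

instance neZero_den (s : ℚ) : NeZero s.den := ⟨s.den_nz⟩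

/-- Both `e^{2πix²s}` and the condition `x ≡ r mod p` depend only on `x` modulo `p * s.den`. -/
theorem residueTheta_rat_add (p : ℕ) [NeZero p] (r : ZMod p) (s : ℚ) {w : ℂ} (hw : 0 < w.im) :
    residueTheta p r (s + w) = ∑ t : ZMod (p * s.den),
      (if ((t.val : ℤ) : ZMod p) = r then
        Complex.exp (2 * Real.pi * Complex.I * (t.val : ℤ) ^ 2 * s) else 0) *
        residueTheta (p * s.den) t w := by
  have hterm (x : ℤ) : residueTerm p r (s + w) x = ∑ t : ZMod (p * s.den),
      (if ((t.val : ℤ) : ZMod p) = r then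
        Complex.exp (2 * Real.pi * Complex.I * (t.val : ℤ) ^ 2 * s) else 0) *
        residueTerm (p * s.den) t w x := by
    rw [Finset.sum_eq_single (x : ZMod (p * s.den))]
    · generalize hv : (((x : ZMod (p * s.den)).val : ℕ) : ℤ) = v
      have hxv : ((x : ℤ) : ZMod (p * s.den)) = (v : ZMod (p * s.den)) := by
        rw [← hv, Int.cast_natCast, ZMod.natCast_zmod_val]
      obtain ⟨t, ht⟩ := (ZMod.intCast_eq_intCast_iff_dvd_sub _ _ _).mp hxv
      obtain rfl : v = x + (p * s.den : ℕ) * t := by linarith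
      have hmod : ((x + (p * s.den : ℕ) * t : ℤ) : ZMod p) = x := by simp
      rw [hmod, residueTerm, residueTerm, if_pos rfl]
      split_ifs with hr
      · rw [← Complex.exp_add, Complex.exp_eq_exp_iff_exists_int]
        refine ⟨-(2 * x * (p * s.num * t) + p * s.num * t * (p * s.den * t)), ?_⟩
        have hs : (s : ℂ) * s.den = s.num := by
          exact_mod_cast congrArg (Rat.cast : ℚ → ℂ) (Rat.mul_den_eq_num s)
        push_cast
        rw [← hs]
        ring
      · rw [zero_mul]
    · intro t _ ht
      rw [residueTerm, if_neg (Ne.symm ht), mul_zero]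
    · intro h
      exact absurd (Finset.mem_univ _) h
  rw [residueTheta]
  simp_rw [hterm]
  rw [Summable.tsum_finsetSum]
  · simp_rw [tsum_mul_left]
    rfl
  · exact fun t _ => (summable_residueTerm _ t hw).mul_left _

theorem hasExpansion_residueTheta_rat (p : ℕ) [NeZero p] (r : ZMod p) (s : ℚ) :
    HasExpansion (4 * (p * s.den) ^ 2) fun τ : ℍ =>
      ((-Complex.I * τ) ^ (1 / 2 : ℂ))⁻¹ * residueTheta p r (s + -1 / τ) := by
  have him (τ : ℍ) : 0 < (-1 / (τ : ℂ)).im := by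
    rw [neg_div, one_div, ← inv_neg]
    exact τ.im_inv_neg_coe_pos
  have key (τ : ℍ) := residueTheta_rat_add p r s (him τ)
  simp_rw [key, Finset.mul_sum, mul_left_comm ((-Complex.I * (_ : ℂ)) ^ (1 / 2 : ℂ))⁻¹]
  exact HasExpansion.sum fun t _ => (hasExpansion_residueTheta (p * s.den) t).const_mul _

/-- The matrix `(s -1; 1 0)`, which maps `∞` to `s`. -/
def cuspMatrix (s : ℚ) : GL(2, ℚ)⁺ :=
  ⟨Matrix.GeneralLinearGroup.mkOfDetNeZero !![s, -1; 1, 0]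
    (by rw [Matrix.det_fin_two_of]; norm_num), by
    rw [Matrix.mem_glpos]
    simp [Matrix.GeneralLinearGroup.mkOfDetNeZero]⟩

theorem toReal_cuspMatrix (s : ℚ) (i j : Fin 2) :
    toReal (cuspMatrix s) i j = (!![(s : ℝ), -1; 1, 0] : Matrix (Fin 2) (Fin 2) ℝ) i j := by
  fin_cases i <;> fin_cases j <;>
    simp [toReal, cuspMatrix, Matrix.GeneralLinearGroup.mkOfDetNeZero]

theorem denom_cuspMatrix (s : ℚ) (τ : ℍ) : denom (toReal (cuspMatrix s)) τ = τ := by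
  simp [denom, toReal_cuspMatrix]

theorem coe_cuspMatrix_smul (s : ℚ) (τ : ℍ) :
    ((toReal (cuspMatrix s) • τ : ℍ) : ℂ) = s + -1 / τ := by
  have := UpperHalfPlane.ne_zero τ
  rw [coe_smul_of_det_pos (toReal_det_pos _), denom_cuspMatrix]
  simp only [num, toReal_cuspMatrix]
  simp
  field_simp

/-- The matrix `(s -1; 1 0)` with the square root `e^{πi/4} √(-iτ)` of `τ`. -/
def cuspElement (s : ℚ) : Metaplectic where
  mat := cuspMatrix s
  root := fun τ => Complex.I ^ (1 / 2 : ℂ) * (-Complex.I * τ) ^ (1 / 2 : ℂ)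
  holo := by
    rw [UpperHalfPlane.mdifferentiable_iff]
    have h : DifferentiableOn ℂ
        (fun z : ℂ => Complex.I ^ (1 / 2 : ℂ) * (-Complex.I * z) ^ (1 / 2 : ℂ))
        {z : ℂ | 0 < z.im} := fun z hz => by
      refine DifferentiableAt.differentiableWithinAt (DifferentiableAt.const_mul ?_ _)
      refine DifferentiableAt.cpow_const (differentiableAt_id.const_mul _) (Or.inl ?_)
      simpa using hz
    refine h.congr fun z hz => ?_
    rw [Function.comp_apply, ofComplex_apply_of_im_pos hz]
  sq := fun τ => by
    have h (z : ℂ) : (z ^ (1 / 2 : ℂ)) ^ 2 = z := by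
      rw [one_div]
      exact_mod_cast Complex.cpow_nat_inv_pow z two_ne_zero
    rw [denom_cuspMatrix, mul_pow, h, h, ← mul_assoc, mul_neg, Complex.I_mul_I, neg_neg, one_mul]

theorem Metaplectic.inv_inv_root (x : Metaplectic) (τ : ℍ) : x.inv.inv.root τ = x.root τ := by
  change ((x.root (toReal x.mat⁻¹ • (toReal x.mat⁻¹⁻¹ • τ)))⁻¹)⁻¹ = x.root τ
  rw [inv_inv, toReal_inv x.mat⁻¹, smul_inv_smul]

theorem cuspMatrix_smul_infty (s : ℚ) :
    (cuspMatrix s : GL (Fin 2) ℚ) • (OnePoint.infty : OnePoint ℚ) = (s : OnePoint ℚ) := by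
  rw [OnePoint.smul_infty_eq_ite]
  simp [cuspMatrix, Matrix.GeneralLinearGroup.mkOfDetNeZero]

theorem isHolomorphicAt_weightedTheta {d p : ℕ} [NeZero p] (f : (Fin d → ZMod p) → ℂ) (s : ℚ) :
    IsHolomorphicAt d (weightedTheta f) s := by
  -- The inverse sends `s` to `∞`, and its operator involves the root of `cuspElement s` itself, a
  -- constant times the `√(-iτ)` of the functional equation. The choice `u = 0` removes the
  -- determinant.
  refine ⟨(cuspElement s).inv, 0, ?_, ?_⟩
  · change ((cuspMatrix s)⁻¹ : GL(2, ℚ)⁺).1 • (s : OnePoint ℚ) = OnePoint.infty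
    rw [← cuspMatrix_smul_infty s]
    exact inv_smul_smul (cuspMatrix s : GL (Fin 2) ℚ) _
  · refine HasExpansion.isHolomorphicAtInfinity (m := 4 * (p * s.den) ^ 2) ?_ ?_
    · have := NeZero.pos p
      have := s.den_pos
      positivity
    · have key (τ : ℍ) : (cuspElement s).inv.op d 0 (weightedTheta f) τ =
          ((Complex.I ^ (1 / 2 : ℂ)) ^ d)⁻¹ * ∑ r, f r * ∏ i,
            -- The `d`-th power of the root is shared out, one factor to each coordinate.
            (((-Complex.I * τ) ^ (1 / 2 : ℂ))⁻¹ * residueTheta p (r i) (s + -1 / τ)) := by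
        have hmat : (cuspElement s).inv.mat⁻¹ = cuspMatrix s := inv_inv (cuspMatrix s)
        rw [Metaplectic.op, Metaplectic.inv_inv_root, hmat, weightedTheta_eq, coe_cuspMatrix_smul,
          neg_zero, Complex.cpow_zero, mul_one, _root_.zpow_neg, zpow_natCast]
        change ((Complex.I ^ (1 / 2 : ℂ) * (-Complex.I * τ) ^ (1 / 2 : ℂ)) ^ d)⁻¹ * _ = _
        rw [mul_pow, mul_inv, mul_assoc]
        congr 1
        rw [Finset.mul_sum]
        refine Finset.sum_congr rfl fun r _ => ?_
        rw [Finset.prod_mul_distrib, Finset.prod_const, Finset.card_univ, Fintype.card_fin,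
          inv_pow, mul_left_comm]
      simp_rw [funext key]
      exact (HasExpansion.sum fun r _ => (HasExpansion.prod fun i _ =>
        hasExpansion_residueTheta_rat p (r i) s).const_mul _).const_mul _

/-! ### Modularity -/

theorem isModularForm_weightedTheta {d p : ℕ} [NeZero p] (f : (Fin d → ZMod p) → ℂ)
    {Γ : Subgroup SL(2, ℤ)} (hcong : IsCongruenceSubgroup Γ) (hle : Γ ≤ Gamma1 4)
    (hΓ : ∀ g ∈ Γ, g 1 1 % 4 = 1 ∧ (p : ℤ) ∣ g 1 1 - 1 ∧ 4 * (p : ℤ) ^ 2 ∣ g 1 0) :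
    IsModularForm d Γ (weightedTheta f) where
  congruence := hcong
  le_Gamma1 := hle
  holomorphic := mdifferentiable_weightedTheta f
  weaklyModular := isWeaklyModular_weightedTheta f hΓ
  holomorphicAtInfinity := ⟨1, one_pos, thetaCoeff f, fun τ => by
    simpa using hasSum_thetaCoeff f τ⟩
  holomorphicAtRational := isHolomorphicAt_weightedTheta f

theorem mem_GammaTwo {g : SL(2, ℤ)} : g ∈ GammaTwo ↔
    g 0 0 ≡ 1 [ZMOD 4] ∧ g 1 1 ≡ 1 [ZMOD 4] ∧ g 1 0 ≡ 0 [ZMOD 16] := Iff.rfl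

theorem mem_GammaOdd {p : ℕ} {g : SL(2, ℤ)} : g ∈ GammaOdd p ↔
    g 0 0 ≡ 1 [ZMOD 4 * p] ∧ g 1 1 ≡ 1 [ZMOD 4 * p] ∧ g 1 0 ≡ 0 [ZMOD 4 * p ^ 2] := Iff.rfl

theorem mem_Gamma_iff_modEq {N : ℕ} {g : SL(2, ℤ)} : g ∈ Gamma N ↔
    g 0 0 ≡ 1 [ZMOD N] ∧ g 0 1 ≡ 0 [ZMOD N] ∧ g 1 0 ≡ 0 [ZMOD N] ∧ g 1 1 ≡ 1 [ZMOD N] := by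
  rw [Gamma_mem]
  simp only [← ZMod.intCast_eq_intCast_iff, Int.cast_one, Int.cast_zero]

theorem mem_Gamma1_iff_modEq {N : ℕ} {g : SL(2, ℤ)} : g ∈ Gamma1 N ↔
    g 0 0 ≡ 1 [ZMOD N] ∧ g 1 1 ≡ 1 [ZMOD N] ∧ g 1 0 ≡ 0 [ZMOD N] := by
  rw [Gamma1_mem]
  simp only [← ZMod.intCast_eq_intCast_iff, Int.cast_one, Int.cast_zero]

theorem isCongruenceSubgroup_GammaTwo : IsCongruenceSubgroup GammaTwo := by
  refine ⟨16, by norm_num, fun g hg => ?_⟩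
  obtain ⟨h1, -, h3, h4⟩ := mem_Gamma_iff_modEq.mp hg
  exact mem_GammaTwo.mpr ⟨h1.of_dvd ⟨4, rfl⟩, h4.of_dvd ⟨4, rfl⟩, h3⟩

theorem GammaTwo_le_Gamma1 : GammaTwo ≤ Gamma1 4 := fun g hg => by
  obtain ⟨h1, h2, h3⟩ := mem_GammaTwo.mp hg
  exact mem_Gamma1_iff_modEq.mpr ⟨h1, h2, h3.of_dvd ⟨4, rfl⟩⟩

theorem isCongruenceSubgroup_GammaOdd (p : ℕ) [NeZero p] :
    IsCongruenceSubgroup (GammaOdd p) := by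
  refine ⟨4 * p ^ 2, by have := NeZero.ne p; positivity, fun g hg => ?_⟩
  obtain ⟨h1, -, h3, h4⟩ := mem_Gamma_iff_modEq.mp hg
  push_cast at h1 h3 h4
  have h : (4 * p : ℤ) ∣ 4 * p ^ 2 := ⟨p, by ring⟩
  exact mem_GammaOdd.mpr ⟨h1.of_dvd h, h4.of_dvd h, h3⟩

theorem GammaOdd_le_Gamma1 (p : ℕ) : GammaOdd p ≤ Gamma1 4 := fun g hg => by
  obtain ⟨h1, h2, h3⟩ := mem_GammaOdd.mp hg
  exact mem_Gamma1_iff_modEq.mpr ⟨h1.of_dvd ⟨p, rfl⟩, h2.of_dvd ⟨p, rfl⟩, h3.of_dvd ⟨p ^ 2, rfl⟩⟩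

end WeightedTheta

end

theorem theorem1p3 (d : ℕ) (hd : 1 ≤ d) (p : ℕ) (hp : p.Prime) (f : (Fin d → ZMod p) → ℂ) :
    (∀ τ : ℍ, Summable (WeightedTheta.thetaTerm f τ) ∧
      HasSum (fun n : ℕ => WeightedTheta.thetaCoeff f n *
        Complex.exp (2 * Real.pi * Complex.I * (τ : ℂ)) ^ n) (WeightedTheta.weightedTheta f τ)) ∧
    (p = 2 →
      WeightedTheta.IsModularForm d WeightedTheta.GammaTwo (WeightedTheta.weightedTheta f)) ∧
    (p ≠ 2 →
      WeightedTheta.IsModularForm d (WeightedTheta.GammaOdd p)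
        (WeightedTheta.weightedTheta f)) := by
  have : NeZero p := ⟨hp.ne_zero⟩
  refine ⟨fun τ => ⟨(WeightedTheta.hasSum_thetaTerm f τ).summable,
    WeightedTheta.hasSum_thetaCoeff f τ⟩, ?_, fun _ => ?_⟩
  · rintro rfl
    refine WeightedTheta.isModularForm_weightedTheta f
      WeightedTheta.isCongruenceSubgroup_GammaTwo WeightedTheta.GammaTwo_le_Gamma1 fun g hg => ?_
    obtain ⟨-, h2, h3⟩ := WeightedTheta.mem_GammaTwo.mp hg
    -- For `p = 2` the modulus `4p²` is `16`, and `d ≡ 1 mod 4` already gives `d ≡ 1 mod p`.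
    rw [Int.ModEq] at h2 h3
    push_cast
    omega
  · refine WeightedTheta.isModularForm_weightedTheta f
      (WeightedTheta.isCongruenceSubgroup_GammaOdd p) (WeightedTheta.GammaOdd_le_Gamma1 p)
      fun g hg => ?_
    obtain ⟨-, h2, h3⟩ := WeightedTheta.mem_GammaOdd.mp hg
    exact ⟨h2.of_dvd ⟨p, rfl⟩, (h2.of_dvd ⟨4, mul_comm _ _⟩).symm.dvd, h3.symm.dvd.trans (by simp)⟩
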